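/- Conventions. Order types are isomorphism types of linear orders; $\varphi \leqslant \psi$ means that an order of type $\varphi$ embeds into one of type $\psi$; $\varphi^*$ is the reverse of $\varphi$; the product $\tau\varphi$ is the type of the order obtained from an order of type $\varphi$ by replacing every point with a copy of $\tau$ (so $\omega_1\omega$ is a sequence, of type $\omega$, of copies of $\omega_1$), and $\varphi^n$ is the corresponding $n$-fold product. $\omega_1^\omega$ denotes ordinal exponentiation. An order is scattered if it does not embed $\mathbb{Q}$, and $\sigma$-scattered if it is a union of countably many scattered suborders. For order types $\tau,\varphi_0,\dots,\varphi_k,\psi$, the relation $\tau \longrightarrow (\varphi_0\vee\dots\vee\varphi_k,\psi)^2$ means: for every linear order $P$ of type $\tau$ and every $f:[P]^2\to\{0,1\}$, there is either a suborder $Q\subseteq P$ whose type is one of $\varphi_0,\dots,\varphi_k$ with $f$ constantly $0$ on $[Q]^2$, or a suborder $Q\subseteq P$ of type $\psi$ with $f$ constantly $1$ on $[Q]^2$; $\not\longrightarrow$ is its negation. Theorem. Assume $\omega_1\omega \not\longrightarrow (\omega_1\omega, 3)^2$. Let $\tau$ be a $\sigma$-scattered linear order type of size at most $\aleph_1$,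 and let $\rho$ be a linear order type such that $(\omega\omega^*)^n \leqslant \rho$ for all natural numbers $n$. Then $$\tau \not\longrightarrow \big(\omega_1^{\omega} \vee (\omega_1^{\omega})^* \vee \omega_1\rho \vee \omega_1^*\rho \vee \rho\omega_1 \vee \rho\omega_1^*,\ 3\big)^2.$$ -/

import Mathlib

universe u

namespace OrderType

/-- The reverse `φ*` of an order type `φ`. -/
noncomputable def dual (φ : OrderType.{u}) : OrderType.{u} :=
  φ.liftOn (fun α _ => type αᵒᵈ) fun _ _ _ _ h =>
    (OrderIso.dual (type_eq_type.mp h).some).type_congr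

/-- The order type of (the set of predecessors of) an ordinal. -/
noncomputable def ofOrdinal (o : Ordinal.{u}) : OrderType.{u} :=
  type o.ToType

/-- The order type `ω₁` of the first uncountable ordinal. -/
noncomputable def omega1 : OrderType.{u} :=
  ofOrdinal (Ordinal.omega 1)

/-- The order type `ω₁ ^ ω` (ordinal exponentiation). -/
noncomputable def omega1PowOmega : OrderType.{u} :=
  ofOrdinal (Ordinal.omega 1 ^ Ordinal.omega0)

/-- The finite order type `n`, that is, the type of an `n`-element chain. -/
noncomputable def finite (n : ℕ) : OrderType.{u} :=
  lift.{u} (type (Fin n))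

/-- An order type is scattered if the order type of the rationals does not embed into it. -/
def IsScattered (φ : OrderType.{u}) : Prop :=
  ¬ lift.{u} eta ≤ φ

/-- An order type is `σ`-scattered if orders of this type are countable unions of scattered
suborders. -/
def IsSigmaScattered (φ : OrderType.{u}) : Prop :=
  ∀ (P : Type u) [LinearOrder P], type P = φ →
    ∃ S : ℕ → Set P, (∀ n, IsScattered (type (S n))) ∧ ⋃ n, S n = Set.univ

/-- The partition relation with alternatives: `Arrow τ d Φ` says that for every order `P` of type
`τ` and every colouring `f` of the `d`-element subsets of `P` with `n + 1` colours there are a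
colour `i` and a suborder `Q` of `P` whose order type is one of the alternatives in `Φ i`, such
that all the `d`-element subsets of `Q` have colour `i`. -/
def Arrow (τ : OrderType.{u}) (d : ℕ) {n : ℕ} (Φ : Fin (n + 1) → Set OrderType.{u}) : Prop :=
  ∀ (P : Type u) [LinearOrder P], type P = τ →
    ∀ f : {s : Finset P // s.card = d} → Fin (n + 1),
      ∃ i : Fin (n + 1), ∃ φ ∈ Φ i, ∃ Q : Set P, type Q = φ ∧
        ∀ s : {s : Finset P // s.card = d}, (s.1 : Set P) ⊆ Q → f s = i

end OrderType

/-! A set is poor of level `n` when it contains no `n`-fold iterated sequence of shape `ω₁`, of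
shape `ω₁*`, or of both shapes `ω` and `ω*` at every stage. Levels add under unions
(`Rich.or_of_union`), and a monotone or antitone map to `ω₁` with fibres of level `n` has a domain
of level `n + 2` (`Poor.of_fibres`). A Hausdorff condensation then splits every scattered set in an
order of size at most `ℵ₁`, hence every such `σ`-scattered order `P`, into pieces `c ⁻¹' {n}` of
level `n` (`sigmaPoor_of_isScattered`).

Inject `P` into `ω₁ω` by sending the `n`-th piece into the `n`-th copy of `ω₁`, and pull back a
colouring that witnesses the hypothesis. Triples of colour 1 are excluded at once. A set of colour 0
has uncountable image in only finitely many copies, since otherwise its image would contain `ω₁ω`;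
so it is covered by a poor set and a countable set. None of the six types can be covered in this way
(`type_notMem_of_subset`). -/

open Set

/-! ### Iterated sequences of sets. -/

namespace OrderType

/-- `Rich R n X` says that `X` contains `n`-fold iterated sequences, of every shape in `R`,
of nonempty sets. -/
def Rich {I : Type*} {P : Type*} [LinearOrder P] (R : Set (I → I → Prop)) : ℕ → Set P → Prop
  | 0, X => X.Nonempty
  | n + 1, X => ∀ r ∈ R, ∃ F : I → Set P, (∀ i, F i ⊆ X ∧ Rich R n (F i)) ∧
      ∀ i j, r i j → ∀ x ∈ F i, ∀ y ∈ F j, x < y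

section Rich

variable {I : Type*} {P : Type*} [LinearOrder P] {R : Set (I → I → Prop)}

theorem Rich.mono {n : ℕ} {X Y : Set P} (hX : Rich R n X) (h : X ⊆ Y) : Rich R n Y := by
  cases n with
  | zero => exact Set.Nonempty.mono h hX
  | succ n =>
    intro r hr
    obtain ⟨F, hF, hlt⟩ := hX r hr
    exact ⟨F, fun i => ⟨(hF i).1.trans h, (hF i).2⟩, hlt⟩

theorem Rich.pred [Nonempty I] (hR : R.Nonempty) {n : ℕ} {X : Set P} (hX : Rich R (n + 1) X) :
    Rich R n X := by
  obtain ⟨r, hr⟩ := hR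
  obtain ⟨F, hF, -⟩ := hX r hr
  exact (hF (Classical.arbitrary I)).2.mono (hF _).1

theorem Rich.of_le [Nonempty I] (hR : R.Nonempty) {m n : ℕ} (hmn : m ≤ n) {X : Set P}
    (hX : Rich R n X) : Rich R m X := by
  induction n, hmn using Nat.le_induction with
  | base => exact hX
  | succ n _ ih => exact ih (hX.pred hR)

theorem Rich.nonempty [Nonempty I] (hR : R.Nonempty) {n : ℕ} {X : Set P} (hX : Rich R n X) :
    X.Nonempty :=
  Rich.of_le hR (Nat.zero_le n) hX

/-- If `X` is not `m`-rich, neither is any trace `F i ∩ X`, so by induction every trace `F i ∩ Y` is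
rich. The family keeps its whole index set, so no thinning is needed. -/
theorem Rich.or_of_union {m n : ℕ} {X Y : Set P} (h : Rich R (m + n) (X ∪ Y)) :
    Rich R m X ∨ Rich R n Y := by
  induction n generalizing X Y with
  | zero =>
    rcases Y.eq_empty_or_nonempty with rfl | hY
    · exact Or.inl (h.mono (by simp))
    · exact Or.inr hY
  | succ n ih =>
    by_contra! hc
    refine hc.2 fun r hr => ?_
    obtain ⟨F, hF, hlt⟩ := h r hr
    refine ⟨fun i => F i ∩ Y, fun i => ⟨inter_subset_right, ?_⟩,
      fun i j hij x hx y hy => hlt i j hij x hx.1 y hy.1⟩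
    refine (ih (X := F i ∩ X) ?_).resolve_left fun h' => hc.1 (h'.mono inter_subset_right)
    exact (hF i).2.mono fun x hx => ((hF i).1 hx).imp (⟨hx, ·⟩) (⟨hx, ·⟩)

/-- A set which is the union of a sequence of sets indexed by a nontrivial order has at least two
points. -/
theorem not_rich_one_of_subsingleton {r : I → I → Prop} (hr : r ∈ R) {i j : I} (hij : r i j)
    {X : Set P} (hX : X.Subsingleton) : ¬ Rich R 1 X := by
  intro h
  obtain ⟨F, hF, hlt⟩ := h r hr
  obtain ⟨x, hx⟩ : (F i).Nonempty := (hF i).2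
  obtain ⟨y, hy⟩ : (F j).Nonempty := (hF j).2
  exact (hlt i j hij x hx y hy).ne (hX ((hF i).1 hx) ((hF j).1 hy))

theorem not_rich_one_of_countable [LinearOrder I] [Uncountable I] {r : I → I → Prop} (hr : r ∈ R)
    (htot : ∀ i j, i ≠ j → r i j ∨ r j i) {X : Set P} (hX : X.Countable) : ¬ Rich R 1 X := by
  intro h
  obtain ⟨F, hF, hlt⟩ := h r hr
  choose p hp using fun i => (show (F i).Nonempty from (hF i).2)
  have : Countable X := hX.to_subtype
  refine not_countable (α := I)
    (Function.Injective.countable (f := fun i => (⟨p i, (hF i).1 (hp i)⟩ : X)) fun i j hij => ?_)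
  by_contra hne
  have hij : p i = p j := congrArg Subtype.val hij
  rcases htot i j hne with h | h
  · exact (hlt i j h _ (hp i) _ (hp j)).ne hij
  · exact (hlt j i h _ (hp j) _ (hp i)).ne hij.symm

end Rich

/-! ### The order `ω₁` and repeated values of maps. -/

/-- The well-order of type `ω₁`. -/
abbrev Omega1 : Type u := (Ordinal.omega 1 : Ordinal.{u}).ToType

theorem mk_Omega1 : Cardinal.mk Omega1.{u} = Cardinal.aleph 1 := by
  rw [Cardinal.mk_toType, Ordinal.card_omega]

instance : Uncountable Omega1.{u} := by
  rw [← Cardinal.aleph0_lt_mk_iff, mk_Omega1]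
  exact Cardinal.aleph0_lt_aleph_one

theorem countable_Iio_of_eq_ord {o : Ordinal.{u}} (ho : o = (Cardinal.aleph 1).ord) (w : o.ToType) :
    (Iio w).Countable := by
  subst ho
  have := Cardinal.mk_Iio_lt w (by simp)
  rw [Cardinal.mk_ord_toType] at this
  rwa [Cardinal.lt_aleph_one_iff, Cardinal.le_aleph0_iff_set_countable] at this

theorem countable_Iic_Omega1 (w : Omega1.{u}) : (Iic w).Countable := by
  rw [← Iio_insert]
  exact (countable_Iio_of_eq_ord (Cardinal.ord_aleph 1).symm w).insert w

instance : NoMaxOrder Omega1.{u} where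
  exists_gt w := by
    by_contra! h
    exact not_countable (α := Omega1.{u})
      (countable_univ_iff.mp ((countable_Iic_Omega1 w).mono fun x _ => h x))

theorem exists_lt_lt_eq_of_antitone {I W : Type*} [LinearOrder I] [NoMaxOrder I] [Nonempty I]
    [LinearOrder W] [WellFoundedLT W] {h : I → W} (hh : Antitone h) :
    ∃ a b c, a < b ∧ b < c ∧ h a = h c := by
  obtain ⟨v, ⟨a, rfl⟩, hmin⟩ := WellFounded.has_min (wellFounded_lt (α := W)) (range h)
    (range_nonempty h)
  obtain ⟨b, hb⟩ := exists_gt a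
  obtain ⟨c, hc⟩ := exists_gt b
  exact ⟨a, b, c, hb, hc, le_antisymm (not_lt.mp (hmin _ ⟨c, rfl⟩)) (hh (hb.trans hc).le)⟩

theorem exists_lt_lt_eq_of_countable {I W : Type*} [LinearOrder I] [Uncountable I]
    {h : I → W} (hh : (range h).Countable) :
    ∃ a b c, a < b ∧ b < c ∧ h a = h c := by
  have : ∃ v ∈ range h, ¬ (h ⁻¹' {v}).Countable := by
    by_contra! hc
    refine not_countable (α := I) (countable_univ_iff.mp ((hh.biUnion hc).mono fun i _ => ?_))
    exact mem_biUnion (mem_range_self i) rfl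
  obtain ⟨v, -, hv⟩ := this
  have hinf : (h ⁻¹' {v}).Infinite := fun hf => hv hf.countable
  obtain ⟨s, hs, hcard⟩ := hinf.exists_subset_card_eq 3
  let e := s.orderEmbOfFin hcard
  have he : ∀ i, h (e i) = v := fun i => hs (s.orderEmbOfFin_mem hcard i)
  exact ⟨e 0, e 1, e 2, e.strictMono (by decide), e.strictMono (by decide),
    (he 0).trans (he 2).symm⟩

/-! ### Rich fibres of monotone maps. -/

section Fibre

variable {I : Type*} {P W : Type*} [LinearOrder P] [LinearOrder W] [LinearOrder I]

/-- All of `F b` lies between `p a` and `p c`, where `g` takes the same value, so `g` is constant on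
it. -/
theorem subset_fibre {A : Set P} {g : P → W} (hg : MonotoneOn g A ∨ AntitoneOn g A)
    {r : I → I → Prop} (hr : r = (· < ·) ∨ r = (· > ·)) {F : I → Set P} (hF : ∀ i, F i ⊆ A)
    (hlt : ∀ i j, r i j → ∀ x ∈ F i, ∀ y ∈ F j, x < y) {p : I → P} (hp : ∀ i, p i ∈ F i)
    {a b c : I} (hab : a < b) (hbc : b < c) (hac : g (p a) = g (p c)) :
    F b ⊆ A ∩ g ⁻¹' {g (p a)} := by
  intro y hy
  have hy' := hF b hy
  have ha := hF a (hp a)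
  have hc := hF c (hp c)
  refine ⟨hy', ?_⟩
  rcases hr with rfl | rfl
  · have h1 := (hlt a b hab _ (hp a) y hy).le
    have h2 := (hlt b c hbc y hy _ (hp c)).le
    rcases hg with hg | hg
    · exact le_antisymm ((hg hy' hc h2).trans hac.ge) (hg ha hy' h1)
    · exact le_antisymm (hg ha hy' h1) (hac.le.trans (hg hy' hc h2))
  · have h1 := (hlt b a hab y hy _ (hp a)).le
    have h2 := (hlt c b hbc _ (hp c) y hy).le
    rcases hg with hg | hg
    · exact le_antisymm (hg hy' ha h1) (hac.le.trans (hg hc hy' h2))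
    · exact le_antisymm ((hg hc hy' h2).trans hac.ge) (hg hy' ha h1)

/-- Along a sequence running against the direction of `g` the values descend in a well-order, hence
become constant. This costs one level. -/
theorem Rich.exists_fibre_of_antitone [NoMaxOrder I] [Nonempty I] [WellFoundedLT W]
    {R : Set (I → I → Prop)} {n : ℕ} {A : Set P} {g : P → W}
    (hg : MonotoneOn g A ∧ (· > ·) ∈ R ∨ AntitoneOn g A ∧ (· < ·) ∈ R) (hA : Rich R (n + 1) A) :
    ∃ v, Rich R n (A ∩ g ⁻¹' {v}) := by
  have hR : R.Nonempty := hg.elim (fun h => ⟨_, h.2⟩) fun h => ⟨_, h.2⟩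
  rcases hg with ⟨hg, hr⟩ | ⟨hg, hr⟩ <;>
  · obtain ⟨F, hF, hlt⟩ := hA _ hr
    choose p hp using fun i => (hF i).2.nonempty hR
    have hanti : Antitone fun i => g (p i) := by
      intro i j hij
      rcases hij.eq_or_lt with rfl | hij
      · exact le_rfl
      · first
          | exact hg ((hF j).1 (hp j)) ((hF i).1 (hp i)) (hlt j i hij _ (hp j) _ (hp i)).le
          | exact hg ((hF i).1 (hp i)) ((hF j).1 (hp j)) (hlt i j hij _ (hp i) _ (hp j)).le
    obtain ⟨a, b, c, hab, hbc, hac⟩ := exists_lt_lt_eq_of_antitone hanti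
    refine ⟨g (p a), (hF b).2.mono (subset_fibre (r := _) ?_ ?_ (fun i => (hF i).1) hlt hp
      hab hbc hac)⟩
    · first | exact Or.inl hg | exact Or.inr hg
    · first | exact Or.inl rfl | exact Or.inr rfl

end Fibre

/-- Here the values may increase along the sequence. The first level bounds `g` on `F i` by its
value at a point of `F j`, leaving countably many values; at the second level one of them must recur
among uncountably many pieces. -/
theorem Rich.exists_fibre_of_bounded {P : Type*} [LinearOrder P]
    {r : Omega1.{u} → Omega1.{u} → Prop} {n : ℕ} {A : Set P} {g : P → Omega1.{u}}
    (hg : MonotoneOn g A ∧ r = (· < ·) ∨ AntitoneOn g A ∧ r = (· > ·))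
    (hA : Rich {r} (n + 2) A) :
    ∃ v, Rich {r} n (A ∩ g ⁻¹' {v}) := by
  have hR : ({r} : Set (Omega1.{u} → Omega1.{u} → Prop)).Nonempty := ⟨r, rfl⟩
  obtain ⟨F, hF, hlt⟩ := hA r rfl
  obtain ⟨i, j, hij⟩ : ∃ i j : Omega1.{u}, i < j :=
    ⟨_, exists_gt (Classical.arbitrary Omega1.{u})⟩
  obtain ⟨q, hq⟩ := (hF j).2.nonempty hR
  have hbd : ∀ x ∈ F i, g x ≤ g q := by
    intro x hx
    rcases hg with ⟨hg, rfl⟩ | ⟨hg, rfl⟩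
    · exact hg ((hF i).1 hx) ((hF j).1 hq) (hlt i j hij x hx q hq).le
    · exact hg ((hF j).1 hq) ((hF i).1 hx) (hlt j i hij q hq x hx).le
  obtain ⟨G, hG, hGlt⟩ := (hF i).2 r rfl
  choose p hp using fun i => (hG i).2.nonempty hR
  obtain ⟨a, b, c, hab, hbc, hac⟩ := exists_lt_lt_eq_of_countable (h := fun i => g (p i))
    ((countable_Iic_Omega1 (g q)).mono (by
      rintro _ ⟨k, rfl⟩
      exact hbd _ ((hG k).1 (hp k))))
  exact ⟨g (p a), (hG b).2.mono (subset_fibre (hg.imp And.left And.left)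
    (hg.imp And.right And.right) (fun k => (hG k).1.trans (hF i).1) hGlt hp hab hbc hac)⟩

/-! ### Poor sets, and scattered orders as countable unions of them. -/

section Poor

variable {P : Type u} [LinearOrder P]

/-- `Poor n X` says that `X` contains none of `ω₁ ^ n`, its reverse, and `(ω ω*) ^ n`, in the sense
of `Rich`. -/
def Poor (n : ℕ) (X : Set P) : Prop :=
  ¬ Rich {((· < ·) : Omega1.{u} → Omega1.{u} → Prop)} n X ∧
  ¬ Rich {((· > ·) : Omega1.{u} → Omega1.{u} → Prop)} n X ∧
  ¬ Rich {((· < ·) : ℕ → ℕ → Prop), (· > ·)} n X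

theorem Poor.mono {m n : ℕ} {X Y : Set P} (hX : Poor m X) (hmn : m ≤ n) (hYX : Y ⊆ X) :
    Poor n Y :=
  ⟨fun h => hX.1 ((h.mono hYX).of_le (singleton_nonempty _) hmn),
    fun h => hX.2.1 ((h.mono hYX).of_le (singleton_nonempty _) hmn),
    fun h => hX.2.2 ((h.mono hYX).of_le ⟨_, Or.inl rfl⟩ hmn)⟩

theorem poor_empty (n : ℕ) : Poor n (∅ : Set P) :=
  Poor.mono (m := 0) ⟨not_nonempty_empty, not_nonempty_empty, not_nonempty_empty⟩
    (Nat.zero_le n) Subset.rfl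

theorem Poor.union {m n : ℕ} {X Y : Set P} (hX : Poor m X) (hY : Poor n Y) :
    Poor (m + n) (X ∪ Y) :=
  ⟨fun h => h.or_of_union.elim hX.1 hY.1, fun h => h.or_of_union.elim hX.2.1 hY.2.1,
    fun h => h.or_of_union.elim hX.2.2 hY.2.2⟩

theorem poor_one_of_subsingleton {X : Set P} (hX : X.Subsingleton) : Poor 1 X := by
  obtain ⟨i, j, hij⟩ : ∃ i j : Omega1.{u}, i < j :=
    ⟨_, exists_gt (Classical.arbitrary Omega1.{u})⟩
  exact ⟨not_rich_one_of_subsingleton (mem_singleton _) hij hX,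
    not_rich_one_of_subsingleton (mem_singleton _) (show j > i from hij) hX,
    not_rich_one_of_subsingleton (Or.inl rfl) Nat.zero_lt_one hX⟩

theorem Poor.of_fibres {n : ℕ} {A : Set P} {g : P → Omega1.{u}}
    (hg : MonotoneOn g A ∨ AntitoneOn g A) (hA : ∀ v, Poor n (A ∩ g ⁻¹' {v})) :
    Poor (n + 2) A := by
  refine ⟨fun h => ?_, fun h => ?_, fun h => ?_⟩
  · rcases hg with hg | hg
    · obtain ⟨v, hv⟩ := h.exists_fibre_of_bounded (Or.inl ⟨hg, rfl⟩)
      exact (hA v).1 hv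
    · obtain ⟨v, hv⟩ := h.exists_fibre_of_antitone (Or.inr ⟨hg, mem_singleton _⟩)
      exact (hA v).1 (hv.pred (singleton_nonempty _))
  · rcases hg with hg | hg
    · obtain ⟨v, hv⟩ := h.exists_fibre_of_antitone (Or.inl ⟨hg, mem_singleton _⟩)
      exact (hA v).2.1 (hv.pred (singleton_nonempty _))
    · obtain ⟨v, hv⟩ := h.exists_fibre_of_bounded (Or.inr ⟨hg, rfl⟩)
      exact (hA v).2.1 hv
  -- The third kind of richness offers both directions at every level, so one of them always runs
  -- against `g`.
  · rcases hg with hg | hg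
    · obtain ⟨v, hv⟩ := h.exists_fibre_of_antitone (Or.inl ⟨hg, Or.inr rfl⟩)
      exact (hA v).2.2 (hv.pred ⟨_, Or.inl rfl⟩)
    · obtain ⟨v, hv⟩ := h.exists_fibre_of_antitone (Or.inr ⟨hg, Or.inl rfl⟩)
      exact (hA v).2.2 (hv.pred ⟨_, Or.inl rfl⟩)

/-- `SigmaPoor S` says that `S` is a union of countably many poor sets. -/
def SigmaPoor (S : Set P) : Prop :=
  ∃ c : P → ℕ, ∀ n, Poor n (S ∩ c ⁻¹' {n})

theorem SigmaPoor.mono {S T : Set P} (hS : SigmaPoor S) (h : T ⊆ S) : SigmaPoor T :=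
  let ⟨c, hc⟩ := hS
  ⟨c, fun n => (hc n).mono le_rfl (inter_subset_inter_left _ h)⟩

theorem sigmaPoor_of_subsingleton {S : Set P} (hS : S.Subsingleton) : SigmaPoor S := by
  -- The label is 1, since a nonempty set is never poor of level 0.
  refine ⟨fun _ => 1, fun n => ?_⟩
  rcases eq_or_ne n 1 with rfl | hn
  · exact poor_one_of_subsingleton (hS.anti inter_subset_left)
  · exact (poor_empty n).mono le_rfl fun x hx => hn (Eq.symm hx.2)

theorem SigmaPoor.iUnion {S : ℕ → Set P} (hS : ∀ m, SigmaPoor (S m)) : SigmaPoor (⋃ m, S m) := by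
  classical
  choose c hc using hS
  have hm : ∀ x, ∃ m, x ∈ ⋃ m, S m → x ∈ S m := fun x => by
    by_cases hx : x ∈ ⋃ m, S m
    · obtain ⟨m, hm⟩ := mem_iUnion.mp hx
      exact ⟨m, fun _ => hm⟩
    · exact ⟨0, fun h => absurd h hx⟩
  choose m hm using hm
  -- The code of a pair is at least its second entry, so the level only grows.
  refine ⟨fun x => Nat.pair (m x) (c (m x) x), fun n => ?_⟩
  refine (hc n.unpair.1 n.unpair.2).mono n.unpair_right_le fun x hx => ?_
  obtain ⟨hx, rfl⟩ := hx
  simpa using hm x hx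

theorem SigmaPoor.union {S T : Set P} (hS : SigmaPoor S) (hT : SigmaPoor T) :
    SigmaPoor (S ∪ T) :=
  (SigmaPoor.iUnion (S := fun m => if m = 0 then S else T) fun m => by
    split_ifs <;> assumption).mono <| union_subset
      (subset_iUnion_of_subset 0 (by simp)) (subset_iUnion_of_subset 1 (by simp))

theorem SigmaPoor.of_fibres {S : Set P} {g : P → Omega1.{u}}
    (hg : MonotoneOn g S ∨ AntitoneOn g S) (hS : ∀ v, SigmaPoor (S ∩ g ⁻¹' {v})) :
    SigmaPoor S := by
  choose c hc using hS
  -- The shift by 2 pays for `Poor.of_fibres`.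
  refine ⟨fun x => c (g x) x + 2, fun n => ?_⟩
  rcases lt_or_ge n 2 with hn | hn
  · refine (poor_empty n).mono le_rfl fun x hx => ?_
    have : c (g x) x + 2 = n := hx.2
    omega
  · obtain ⟨n, rfl⟩ := Nat.exists_eq_add_of_le' hn
    refine Poor.of_fibres (g := g) (hg.imp (·.mono inter_subset_left) (·.mono inter_subset_left))
      fun v => (hc v n).mono le_rfl ?_
    rintro x ⟨⟨hx, hxn⟩, rfl⟩
    exact ⟨⟨hx, rfl⟩, Nat.add_right_cancel hxn⟩

/-- A set all of whose intervals with a fixed endpoint are countable unions of poor sets is such a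
union itself, when its size is at most `ℵ₁`. -/
theorem sigmaPoor_of_forall_uIcc (hP : Cardinal.mk P ≤ Cardinal.aleph 1) {E S : Set P}
    (hES : E ⊆ S) (x : P) (hE : ∀ y ∈ E, SigmaPoor (S ∩ uIcc x y)) : SigmaPoor E := by
  rcases E.eq_empty_or_nonempty with rfl | hne
  · exact sigmaPoor_of_subsingleton subsingleton_empty
  have : Nonempty E := hne.to_subtype
  obtain ⟨j⟩ : Nonempty (E ↪ Omega1.{u}) := by
    rw [← Cardinal.le_def, mk_Omega1]
    exact (Cardinal.mk_set_le E).trans hP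
  have hsurj := Function.invFun_surjective j.injective
  set e : Omega1.{u} → E := Function.invFun j
  have hwf := wellFounded_lt (α := Omega1.{u})
  -- With `e` enumerating `E` along `ω₁`, `v` is the first index whose point bounds `y` from above.
  -- This is monotone in `y`, and its fibre over `v`, to the right of `x`, lies between `x` and `e
  -- v`. `hdown` is the mirror image.
  have hup : ∀ y, ∃ v, y ∈ E → y ≤ e v ∧ ∀ w, y ≤ e w → v ≤ w := fun y => by
    by_cases hy : y ∈ E
    · obtain ⟨v, hv, hmin⟩ := hwf.has_min {v | y ≤ e v} <| by
        obtain ⟨v, hv⟩ := hsurj ⟨y, hy⟩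
        exact ⟨v, by simp [hv]⟩
      exact ⟨v, fun _ => ⟨hv, fun w hw => not_lt.mp (hmin w hw)⟩⟩
    · exact ⟨Classical.arbitrary _, fun h => absurd h hy⟩
  have hdown : ∀ y, ∃ v, y ∈ E → e v ≤ y ∧ ∀ w, e w ≤ y → v ≤ w := fun y => by
    by_cases hy : y ∈ E
    · obtain ⟨v, hv, hmin⟩ := hwf.has_min {v | e v ≤ y} <| by
        obtain ⟨v, hv⟩ := hsurj ⟨y, hy⟩
        exact ⟨v, by simp [hv]⟩
      exact ⟨v, fun _ => ⟨hv, fun w hw => not_lt.mp (hmin w hw)⟩⟩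
    · exact ⟨Classical.arbitrary _, fun h => absurd h hy⟩
  choose g hg using hup
  choose d hd using hdown
  have h1 : SigmaPoor (E ∩ Ici x) := by
    refine SigmaPoor.of_fibres (g := g) (Or.inl ?_) fun v => (hE _ (e v).2).mono ?_
    · intro y hy z hz hyz
      exact (hg y hy.1).2 _ (hyz.trans (hg z hz.1).1)
    · rintro y ⟨⟨hy, hxy⟩, rfl⟩
      exact ⟨hES hy, Icc_subset_uIcc ⟨hxy, (hg y hy).1⟩⟩
  have h2 : SigmaPoor (E ∩ Iic x) := by
    refine SigmaPoor.of_fibres (g := d) (Or.inr ?_) fun v => (hE _ (e v).2).mono ?_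
    · intro y hy z hz hyz
      exact (hd z hz.1).2 _ ((hd y hy.1).1.trans hyz)
    · rintro y ⟨⟨hy, hxy⟩, rfl⟩
      exact ⟨hES hy, Icc_subset_uIcc' ⟨(hd y hy).1, hxy⟩⟩
  exact (h1.union h2).mono fun y hy => (le_total x y).imp (⟨hy, ·⟩) (⟨hy, ·⟩)

/-- Identify two points when the part of `S` between them is `SigmaPoor`. The classes are convex and
`SigmaPoor`; two distinct classes would make the quotient a nontrivial dense order, giving a copy of
`ℚ` in `S`. -/
theorem sigmaPoor_of_isScattered (hP : Cardinal.mk P ≤ Cardinal.aleph 1) {S : Set P}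
    (hS : IsScattered (type S)) : SigmaPoor S := by
  let s : Setoid S :=
    { r := fun x y => SigmaPoor (S ∩ uIcc (x : P) y)
      iseqv :=
        { refl := fun x => sigmaPoor_of_subsingleton
            (by rw [uIcc_self]; exact subsingleton_singleton.anti inter_subset_right)
          symm := fun {x y} h => by rwa [uIcc_comm]
          trans := fun {x y z} h h' => (h.union h').mono <| by
            rw [← inter_union_distrib_left]
            exact inter_subset_inter_right _ uIcc_subset_uIcc_union_uIcc } }
  have hclass : ∀ x : S, SigmaPoor {y | ∃ hy : y ∈ S, s x ⟨y, hy⟩} := fun x =>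
    sigmaPoor_of_forall_uIcc hP (fun y hy => hy.1) x fun y hy => hy.2
  by_cases hall : ∀ x y : S, s x y
  · rcases S.eq_empty_or_nonempty with rfl | ⟨x, hx⟩
    · exact sigmaPoor_of_subsingleton subsingleton_empty
    · exact (hclass ⟨x, hx⟩).mono fun y hy => ⟨hy, hall _ _⟩
  exfalso
  push Not at hall
  obtain ⟨x, y, hxy⟩ := hall
  have hconv : ∀ {a b c : S}, a ≤ b → b ≤ c → s a c → s a b ∧ s b c := fun {a b c} hab hbc h =>
    ⟨h.mono (inter_subset_inter_right _ (uIcc_subset_uIcc_left (by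
        rw [uIcc_of_le (show (a : P) ≤ c from hab.trans hbc)]; exact ⟨hab, hbc⟩))),
      h.mono (inter_subset_inter_right _ (uIcc_subset_uIcc_right (by
        rw [uIcc_of_le (show (a : P) ≤ c from hab.trans hbc)]; exact ⟨hab, hbc⟩)))⟩
  -- With no third class in between, the interval would be covered by the classes of `a` and `b`.
  have hdense : ∀ a b : S, a < b → ¬ s a b → ∃ z, a < z ∧ z < b ∧ ¬ s a z ∧ ¬ s z b := by
    intro a b hab hn
    by_contra! hc
    refine hn (((hclass a).union (hclass b)).mono ?_)
    rintro z ⟨hz, hz'⟩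
    rw [uIcc_of_le (show (a : P) ≤ b from hab.le)] at hz'
    by_cases h1 : s a ⟨z, hz⟩
    · exact Or.inl ⟨hz, h1⟩
    · refine Or.inr ⟨hz, s.symm ?_⟩
      rcases hz'.2.eq_or_lt with h | h
      · have : (⟨z, hz⟩ : S) = b := Subtype.ext h
        rw [this]
      · refine hc ⟨z, hz⟩ (lt_of_le_of_ne hz'.1 fun h' => h1 ?_) h h1
        rw [← h']
  let T : Set S := range (Quotient.out : Quotient s → S)
  have hT : ∀ a ∈ T, ∀ b ∈ T, s a b → a = b := by
    rintro _ ⟨a, rfl⟩ _ ⟨b, rfl⟩ h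
    rw [show a = b from Quotient.out_equiv_out.mp h]
  have : DenselyOrdered T := ⟨fun a b hab => by
    obtain ⟨z, haz, hzb, h1, h2⟩ := hdense a b hab fun h => hab.ne (Subtype.ext (hT _ a.2 _ b.2 h))
    have hz : s (Quotient.mk s z).out z := Quotient.mk_out z
    refine ⟨⟨(Quotient.mk s z).out, mem_range_self _⟩, ?_, ?_⟩
    · change (a : S) < (Quotient.mk s z).out
      by_contra! h
      exact h1 (hconv h haz.le hz).2
    · change (Quotient.mk s z).out < (b : S)
      by_contra! h
      exact h2 (hconv hzb.le h (s.symm hz)).1⟩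
  have : Nontrivial T := ⟨⟨⟨_, mem_range_self (Quotient.mk s x)⟩,
    ⟨_, mem_range_self (Quotient.mk s y)⟩, fun h => hxy <| Quotient.exact <|
      Quotient.out_injective <| congrArg Subtype.val h⟩⟩
  obtain ⟨f⟩ := Order.embedding_from_countable_to_dense ℚ T
  exact hS (type_le_type ((ULift.orderIso.toOrderEmbedding.trans f).trans
    (OrderEmbedding.subtype _)))

end Poor

/-! ### Arithmetic of order types, and powers as sources of richness. -/

theorem dual_type (α : Type u) [LinearOrder α] : (type α).dual = type αᵒᵈ := rfl

theorem dual_mul (φ ψ : OrderType.{u}) : (φ * ψ).dual = φ.dual * ψ.dual := by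
  induction φ, ψ using inductionOn₂ with
  | H α β =>
    rw [← type_lex_prod, dual_type, dual_type, dual_type, ← type_lex_prod]
    refine type_congr
      { toFun := fun x => toLex (OrderDual.toDual (ofLex (OrderDual.ofDual x)).1,
          OrderDual.toDual (ofLex (OrderDual.ofDual x)).2)
        invFun := fun x => OrderDual.toDual (toLex (OrderDual.ofDual (ofLex x).1,
          OrderDual.ofDual (ofLex x).2))
        left_inv := fun x => rfl
        right_inv := fun x => rfl
        map_rel_iff' := ?_ }
    intro x y
    change toLex _ ≤ toLex _ ↔ OrderDual.ofDual y ≤ OrderDual.ofDual x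
    rw [Prod.Lex.le_iff, Prod.Lex.le_iff]
    exact or_congr Iff.rfl (and_congr_left' eq_comm)

theorem dual_one : dual (1 : OrderType.{u}) = 1 :=
  type_of_unique (α := PUnitᵒᵈ)

theorem dual_pow (φ : OrderType.{u}) (n : ℕ) : (φ ^ n).dual = φ.dual ^ n := by
  induction n with
  | zero => rw [pow_zero, pow_zero, dual_one]
  | succ n ih => rw [pow_succ, pow_succ, dual_mul, ih]

theorem dual_le_dual {φ ψ : OrderType.{u}} (h : φ ≤ ψ) : φ.dual ≤ ψ.dual := by
  induction φ, ψ using inductionOn₂ with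
  | H α β =>
    obtain ⟨f⟩ := type_le_type_iff.mp h
    exact type_le_type f.dual

theorem ofOrdinal_mul (a b : Ordinal.{u}) : ofOrdinal (a * b) = ofOrdinal a * ofOrdinal b := by
  rw [ofOrdinal, ofOrdinal, ofOrdinal, ← type_lex_prod]
  have h : Ordinal.type ((· < ·) : (a * b).ToType → (a * b).ToType → Prop) =
      Ordinal.type (Prod.Lex ((· < ·) : b.ToType → b.ToType → Prop)
        ((· < ·) : a.ToType → a.ToType → Prop)) := by
    rw [Ordinal.type_prod_lex, Ordinal.type_toType, Ordinal.type_toType, Ordinal.type_toType]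
  obtain ⟨f⟩ := Ordinal.type_eq.mp h
  exact type_congr (OrderIso.ofRelIsoLT (β := b.ToType ×ₗ a.ToType) f)

theorem ofOrdinal_one : ofOrdinal (1 : Ordinal.{u}) = 1 :=
  type_of_unique

theorem ofOrdinal_pow (a : Ordinal.{u}) (n : ℕ) : ofOrdinal (a ^ n) = ofOrdinal a ^ n := by
  induction n with
  | zero => rw [pow_zero, pow_zero, ofOrdinal_one]
  | succ n ih => rw [pow_succ, pow_succ, ofOrdinal_mul, ih]

theorem ofOrdinal_le_ofOrdinal {a b : Ordinal.{u}} (h : a ≤ b) : ofOrdinal a ≤ ofOrdinal b := by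
  rw [← Ordinal.type_toType a, ← Ordinal.type_toType b] at h
  obtain ⟨f⟩ := Ordinal.type_le_iff'.mp h
  exact type_le_type (OrderEmbedding.ofStrictMono f fun i j hij => f.map_rel_iff.mpr hij)

theorem omega1_pow_le_omega1PowOmega (n : ℕ) : omega1.{u} ^ n ≤ omega1PowOmega := by
  rw [omega1, ← ofOrdinal_pow, omega1PowOmega]
  refine ofOrdinal_le_ofOrdinal ?_
  rw [← Ordinal.opow_natCast]
  exact Ordinal.opow_le_opow_right (Ordinal.omega_pos 1) (Ordinal.natCast_lt_omega0 n).le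

theorem rich_of_pow_le {I : Type*} {R : Set (I → I → Prop)} {M P : Type u} [LinearOrder M]
    [LinearOrder P] (hM : ∀ r ∈ R, ∃ e : I → M, ∀ i j, r i j → e i < e j) (n : ℕ) {X : Set P}
    (hX : type M ^ n ≤ type X) : Rich R n X := by
  induction n generalizing X with
  | zero =>
    rw [pow_zero] at hX
    obtain ⟨f⟩ := type_le_type_iff.mp (show type PUnit ≤ type X from hX)
    exact ⟨f PUnit.unit, (f PUnit.unit).2⟩
  | succ n ih =>
    intro r hr
    obtain ⟨e, he⟩ := hM r hr
    rw [pow_succ, ← type_toType (type M ^ n), ← type_lex_prod] at hX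
    obtain ⟨f⟩ := type_le_type_iff.mp hX
    refine ⟨fun i => range fun k => (f (toLex (e i, k)) : P), fun i => ⟨?_, ih ?_⟩, ?_⟩
    · rintro _ ⟨k, rfl⟩
      exact (f _).2
    · refine (type_toType _).symm.le.trans
        (type_le_type (OrderEmbedding.ofStrictMono (fun k => ⟨_, mem_range_self k⟩) ?_))
      intro k l hkl
      exact f.strictMono (Prod.Lex.right _ hkl)
    · rintro i j hij _ ⟨k, rfl⟩ _ ⟨l, rfl⟩
      exact f.strictMono (Prod.Lex.left _ _ (he i j hij))

theorem rich_of_omega0_mul_dual_pow_le {P : Type u} [LinearOrder P] {n : ℕ} {X : Set P}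
    (hX : (omega0.{u} * omega0.{u}.dual) ^ n ≤ type X) :
    Rich {((· < ·) : ℕ → ℕ → Prop), (· > ·)} n X := by
  rw [omega0, ← type_ulift, dual_type, ← type_lex_prod] at hX
  refine rich_of_pow_le ?_ n hX
  rintro r (rfl | rfl)
  -- Increasing sequences stay inside one copy of `ω`; decreasing ones move from copy to copy.
  · exact ⟨fun i => toLex (OrderDual.toDual ⟨0⟩, ⟨i⟩), fun i j hij => Prod.Lex.right _ hij⟩
  · exact ⟨fun i => toLex (OrderDual.toDual ⟨i⟩, ⟨0⟩), fun i j hij => Prod.Lex.left _ _ hij⟩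

/-! ### Types not covered by a poor set and a countable set. -/

section Cover

variable {P : Type u} [LinearOrder P] {X A C : Set P}

theorem type_ne_omega1PowOmega_of_subset {N : ℕ} (hA : Poor N A) (hC : C.Countable)
    (hX : X ⊆ A ∪ C) : type X ≠ omega1PowOmega := by
  intro h
  -- Level `N` is absorbed by `A` and one further level by the countable set `C`.
  have hrich : Rich {((· < ·) : Omega1.{u} → Omega1.{u} → Prop)} (N + 1) X :=
    rich_of_pow_le (M := Omega1.{u})
      (by rintro r rfl; exact ⟨id, fun i j hij => hij⟩) _ (h ▸ omega1_pow_le_omega1PowOmega _)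
  exact (hrich.mono hX).or_of_union.elim hA.1
    (not_rich_one_of_countable (mem_singleton _) (fun i j hij => lt_or_gt_of_ne hij) hC)

theorem type_ne_omega1PowOmega_dual_of_subset {N : ℕ} (hA : Poor N A) (hC : C.Countable)
    (hX : X ⊆ A ∪ C) : type X ≠ omega1PowOmega.dual := by
  intro h
  have hrich : Rich {((· > ·) : Omega1.{u} → Omega1.{u} → Prop)} (N + 1) X := by
    refine rich_of_pow_le (M := Omega1.{u}ᵒᵈ)
      (by rintro r rfl; exact ⟨OrderDual.toDual, fun i j hij => hij⟩) _ ?_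
    rw [h, ← dual_type, ← dual_pow]
    exact dual_le_dual (omega1_pow_le_omega1PowOmega _)
  exact (hrich.mono hX).or_of_union.elim hA.2.1
    (not_rich_one_of_countable (mem_singleton _) (fun i j hij => (lt_or_gt_of_ne hij).symm) hC)

/-- Each of the copies of `U` is uncountable, so it has a point outside `C`; these points form a
copy of `ρ` in `A`. -/
theorem le_type_of_mul_eq {U : Type u} [LinearOrder U] [Uncountable U] (hC : C.Countable)
    (hX : X ⊆ A ∪ C) {ρ : OrderType.{u}} (h : type X = type U * ρ) : ρ ≤ type A := by
  rw [← type_toType ρ, ← type_lex_prod] at h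
  obtain ⟨f⟩ := type_eq_type.mp h
  have hex : ∀ r : ρ.ToType, ∃ w : U, (f.symm (toLex (r, w)) : P) ∉ C := by
    intro r
    by_contra! hc
    have : Countable C := hC.to_subtype
    refine not_countable (α := U)
      (Function.Injective.countable (f := fun w => (⟨_, hc w⟩ : C)) fun w w' hw => ?_)
    have hw : (f.symm (toLex (r, w)) : P) = f.symm (toLex (r, w')) :=
      congrArg (fun x : C => (x : P)) hw
    exact congrArg (fun x => (ofLex x).2) (f.symm.injective (Subtype.ext hw))
  choose w hw using hex
  rw [← type_toType ρ]
  refine type_le_type (OrderEmbedding.ofStrictMono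
    (fun r => ⟨_, (hX (f.symm (toLex (r, w r))).2).resolve_right (hw r)⟩) ?_)
  intro r s hrs
  exact f.symm.strictMono (Prod.Lex.left _ _ hrs)

/-- The copies of `ρ` are disjoint and uncountably many, so the countable set `C` misses one of them
entirely. -/
theorem le_type_of_eq_mul {U : Type u} [LinearOrder U] [Uncountable U] (hC : C.Countable)
    (hX : X ⊆ A ∪ C) {ρ : OrderType.{u}} (h : type X = ρ * type U) : ρ ≤ type A := by
  rw [← type_toType ρ, ← type_lex_prod] at h
  obtain ⟨f⟩ := type_eq_type.mp h
  obtain ⟨w, hw⟩ : ∃ w : U, ∀ r : ρ.ToType, (f.symm (toLex (w, r)) : P) ∉ C := by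
    by_contra! hc
    choose r hr using hc
    have : Countable C := hC.to_subtype
    refine not_countable (α := U)
      (Function.Injective.countable (f := fun w => (⟨_, hr w⟩ : C)) fun w w' hw => ?_)
    have hw : (f.symm (toLex (w, r w)) : P) = f.symm (toLex (w', r w')) :=
      congrArg (fun x : C => (x : P)) hw
    exact congrArg (fun x => (ofLex x).1) (f.symm.injective (Subtype.ext hw))
  rw [← type_toType ρ]
  refine type_le_type (OrderEmbedding.ofStrictMono
    (fun r => ⟨_, (hX (f.symm (toLex (w, r))).2).resolve_right (hw r)⟩) ?_)
  intro r s hrs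
  exact f.symm.strictMono (Prod.Lex.right _ hrs)

theorem type_notMem_of_subset {N : ℕ} (hA : Poor N A) (hC : C.Countable) (hX : X ⊆ A ∪ C)
    {ρ : OrderType.{u}} (hρ : ∀ n : ℕ, (omega0.{u} * omega0.{u}.dual) ^ n ≤ ρ) :
    type X ∉ ({omega1PowOmega, omega1PowOmega.dual, omega1 * ρ, omega1.dual * ρ,
      ρ * omega1, ρ * omega1.dual} : Set OrderType.{u}) := by
  have hle : ¬ ρ ≤ type A := fun h => hA.2.2 (rich_of_omega0_mul_dual_pow_le ((hρ N).trans h))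
  have : Uncountable Omega1.{u}ᵒᵈ := inferInstanceAs (Uncountable Omega1.{u})
  rintro (h | h | h | h | h | h)
  · exact type_ne_omega1PowOmega_of_subset hA hC hX h
  · exact type_ne_omega1PowOmega_dual_of_subset hA hC hX h
  · exact hle (le_type_of_mul_eq (U := Omega1.{u}) hC hX h)
  · exact hle (le_type_of_mul_eq (U := Omega1.{u}ᵒᵈ) hC hX h)
  · exact hle (le_type_of_eq_mul (U := Omega1.{u}) hC hX h)
  · exact hle (le_type_of_eq_mul (U := Omega1.{u}ᵒᵈ) hC hX h)

theorem exists_poor_of_forall_poor {c : P → ℕ} (hc : ∀ n, Poor n (c ⁻¹' {n})) (k : ℕ) :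
    ∃ N, Poor N {x | c x < k} := by
  induction k with
  | zero => exact ⟨0, (poor_empty 0).mono le_rfl fun x hx => absurd hx (Nat.not_lt_zero _)⟩
  | succ k ih =>
    obtain ⟨N, hN⟩ := ih
    exact ⟨N + k, (hN.union (hc k)).mono le_rfl fun x hx => Nat.lt_succ_iff_lt_or_eq.mp hx⟩

end Cover

/-! ### Large subsets of `ω₁ω`, and finite types. -/

theorem exists_orderEmbedding_of_not_countable {Y : Set Omega1.{u}} (hY : ¬ Y.Countable) :
    ∃ f : Omega1.{u} ↪o Omega1.{u}, ∀ i, f i ∈ Y := by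
  have hle : Ordinal.type ((· < ·) : Omega1.{u} → Omega1.{u} → Prop) ≤
      Ordinal.type ((· < ·) : Y → Y → Prop) := by
    refine ((Ordinal.type_toType _).trans (Cardinal.ord_aleph 1).symm).le.trans ?_
    rw [Cardinal.ord_le, Ordinal.card_type]
    by_contra! h
    rw [Cardinal.lt_aleph_one_iff, Cardinal.le_aleph0_iff_set_countable] at h
    exact hY h
  obtain ⟨f⟩ := Ordinal.type_le_iff'.mp hle
  exact ⟨(OrderEmbedding.ofStrictMono f fun i j hij => f.map_rel_iff.mpr hij).trans
    (OrderEmbedding.subtype _), fun i => (f i).2⟩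

theorem exists_subset_type_eq_omega1_mul_omega0 {Y : Set (ULift.{u} ℕ ×ₗ Omega1.{u})}
    (hY : {n : ℕ | ¬ {w : Omega1.{u} | toLex (⟨n⟩, w) ∈ Y}.Countable}.Infinite) :
    ∃ Q ⊆ Y, type Q = omega1.{u} * omega0.{u} := by
  classical
  have := hY.to_subtype
  let e := Nat.orderEmbeddingOfSet {n : ℕ | ¬ {w : Omega1.{u} | toLex (⟨n⟩, w) ∈ Y}.Countable}
  have he : ∀ m, ¬ {w : Omega1.{u} | toLex (⟨e m⟩, w) ∈ Y}.Countable := fun m =>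
    Nat.orderEmbeddingOfSet_range
      {n : ℕ | ¬ {w : Omega1.{u} | toLex (⟨n⟩, w) ∈ Y}.Countable} |>.subset (mem_range_self m)
  choose f hf using fun m => exists_orderEmbedding_of_not_countable (he m)
  let F : ULift.{u} ℕ ×ₗ Omega1.{u} → ULift.{u} ℕ ×ₗ Omega1.{u} := fun x =>
    toLex (⟨e (ofLex x).1.down⟩, f (ofLex x).1.down (ofLex x).2)
  have hF : StrictMono F := by
    intro x y hxy
    rw [Prod.Lex.lt_iff] at hxy ⊢
    rcases hxy with h | ⟨h, h'⟩
    · exact Or.inl (e.strictMono h)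
    · refine Or.inr ⟨congrArg (fun z : ULift.{u} ℕ => ULift.up (e z.down)) h, ?_⟩
      change f _ _ < f _ _
      rw [h]
      exact (f _).strictMono h'
  refine ⟨range F, ?_, ?_⟩
  · rintro _ ⟨x, rfl⟩
    exact hf _ _
  · rw [omega0, ← type_ulift, omega1, ofOrdinal, ← type_lex_prod]
    exact (hF.orderIso F).symm.type_congr

theorem type_eq_finite_of_card {P : Type u} [LinearOrder P] {s : Finset P} {n : ℕ}
    (hs : s.card = n) : type (s : Set P) = finite n := by
  rw [finite, ← type_ulift]
  exact ((s.orderIsoOfFin hs).symm.trans ULift.orderIso.symm).type_congr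

theorem exists_finset_card_eq_of_type_eq_finite {P : Type u} [LinearOrder P] {Q : Set P} {n : ℕ}
    (hQ : type Q = finite n) : ∃ s : Finset P, (s : Set P) = Q ∧ s.card = n := by
  rw [finite, ← type_ulift] at hQ
  obtain ⟨f⟩ := type_eq_type.mp hQ
  have hcard : Nat.card Q = n := by
    rw [Nat.card_congr f.toEquiv, Nat.card_ulift, Nat.card_fin]
  have hfin : Finite Q := Finite.of_equiv _ f.symm.toEquiv
  have hQf : Q.Finite := Set.toFinite Q
  refine ⟨hQf.toFinset, hQf.coe_toFinset, ?_⟩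
  rw [← Nat.card_eq_card_finite_toFinset hQf, hcard]

end OrderType

/-! ### The pulled-back colouring. -/

theorem mainTheorem7
    (h : ¬ OrderType.Arrow (OrderType.omega1.{u} * OrderType.omega0.{u}) 2
      ![{OrderType.omega1.{u} * OrderType.omega0.{u}}, {OrderType.finite.{u} 3}])
    (τ : OrderType.{u}) (hτ : τ.IsSigmaScattered) (hτcard : τ.card ≤ Cardinal.aleph 1)
    (ρ : OrderType.{u})
    (hρ : ∀ n : ℕ, (OrderType.omega0.{u} * OrderType.omega0.{u}.dual) ^ n ≤ ρ) :
    ¬ OrderType.Arrow τ 2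
      ![{OrderType.omega1PowOmega, OrderType.omega1PowOmega.dual,
          OrderType.omega1 * ρ, OrderType.omega1.dual * ρ,
          ρ * OrderType.omega1, ρ * OrderType.omega1.dual},
        {OrderType.finite.{u} 3}] := by
  classical
  open OrderType in
  intro hA
  unfold Arrow at h
  push Not at h
  obtain ⟨P₀, _, hP₀, f₀, hf₀⟩ := h
  have hbad₀ := hf₀ 0 _ (Set.mem_singleton _)
  have hbad₁ := hf₀ 1 _ (Set.mem_singleton _)
  rw [omega0, ← type_ulift, omega1, ofOrdinal, ← type_lex_prod] at hP₀
  obtain ⟨e₀⟩ := type_eq_type.mp hP₀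
  induction τ using inductionOn with
  | H P =>
  rw [card_type] at hτcard
  obtain ⟨S, hS, hSuniv⟩ := hτ P rfl
  obtain ⟨c, hc⟩ := SigmaPoor.iUnion fun n => sigmaPoor_of_isScattered hτcard (hS n)
  simp only [hSuniv, Set.univ_inter] at hc
  obtain ⟨j⟩ : Nonempty (P ↪ Omega1.{u}) := by
    rwa [← Cardinal.le_def, mk_Omega1]
  -- Pairs are coloured as unordered sets, so `G` need only be injective; it does not have to
  -- respect the order.
  let G : P ↪ P₀ := ⟨fun x => e₀.symm (toLex (⟨c x⟩, j x)), fun x y hxy =>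
    j.injective (congrArg (fun z => (ofLex z).2) (e₀.symm.injective hxy))⟩
  obtain ⟨i, φ, hφ, Q, hQ, hom⟩ := hA P rfl fun s => f₀ ⟨s.1.map G, by rw [Finset.card_map, s.2]⟩
  have hom' : ∀ s : {s : Finset P₀ // s.card = 2}, (s.1 : Set P₀) ⊆ G '' Q → f₀ s = i := by
    rintro ⟨s, hs⟩ hsQ
    obtain ⟨t, htQ, rfl⟩ := Finset.subset_set_image_iff.mp hsQ
    have hst : t.image G = t.map G := (Finset.map_eq_image G t).symm
    have ht : t.card = 2 := by rw [← hs, hst, Finset.card_map]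
    rw [← hom ⟨t, ht⟩ htQ]
    exact congrArg f₀ (Subtype.ext hst)
  obtain rfl | rfl : i = 0 ∨ i = 1 := by fin_cases i <;> simp
  · have hcol : {n : ℕ | ¬ {w : Omega1.{u} | toLex (⟨n⟩, w) ∈ e₀ '' (G '' Q)}.Countable}.Finite := by
      by_contra hinf
      obtain ⟨Y, hY, hYtype⟩ := exists_subset_type_eq_omega1_mul_omega0 hinf
      obtain ⟨s, hs, hs0⟩ := hbad₀ (e₀.symm '' Y)
        ((e₀.symm.toOrderEmbedding.strictMono.strictMonoOn Y |>.orderIso _ _).type_congr.symm.trans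
          hYtype)
      refine hs0 (hom' s (hs.trans ?_))
      rintro _ ⟨y, hy, rfl⟩
      obtain ⟨z, hz, rfl⟩ := hY hy
      rwa [OrderIso.symm_apply_apply]
    -- Column `k` itself may be uncountable, so the poor part takes the labels below `k + 1`.
    obtain ⟨k, hk⟩ := hcol.bddAbove
    obtain ⟨N, hN⟩ := exists_poor_of_forall_poor hc (k + 1)
    have hC : (⋃ n ∈ {n | k < n}, Q ∩ c ⁻¹' {n}).Countable := by
      refine (Set.to_countable _).biUnion fun n hn => ?_
      have hcount : {w : Omega1.{u} | toLex (⟨n⟩, w) ∈ e₀ '' (G '' Q)}.Countable := by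
        by_contra hunc
        exact absurd (hk hunc) (not_le.mpr hn)
      refine (hcount.preimage_of_injOn (f := j) j.injective.injOn).mono ?_
      rintro x ⟨hx, rfl⟩
      exact ⟨G x, ⟨x, hx, rfl⟩, e₀.apply_symm_apply _⟩
    refine type_notMem_of_subset (X := Q) hN hC (fun x hx => ?_) hρ (hQ ▸ hφ)
    rcases Nat.lt_or_ge (c x) (k + 1) with h | h
    · exact Or.inl h
    · exact Or.inr (Set.mem_biUnion (x := c x) h ⟨hx, rfl⟩)
  · obtain ⟨s, rfl, hs⟩ := exists_finset_card_eq_of_type_eq_finite (hQ.trans hφ)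
    obtain ⟨t, ht, ht1⟩ := hbad₁ ((s.map G : Finset P₀) : Set P₀)
      (type_eq_finite_of_card (by rw [Finset.card_map, hs]))
    exact ht1 (hom' t (by rwa [Finset.coe_map] at ht))
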